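/- A ringed finite space is a ringed space $(X,\mathcal O_X)$ (with $\mathcal O_X$ a sheaf of commutative rings with unit) whose underlying topological space is finite; a morphism of ringed finite spaces is a morphism of ringed spaces. On a finite space write $p\le q$ if $p\in\overline{\{q\}}$; for $p\le q$ there is a restriction morphism of stalks $r_{pq}\colon\mathcal O_p\to\mathcal O_q$. Let $I=[0,1]$ be the unit interval, and for a ringed space $X$ let $X\times I$ be the topological product with the sheaf of rings $\mathcal O_{X\times I}=\pi_X^{-1}\mathcal O_X$, where $\pi_X\colon X\times I\to X$ is the projection. For $t\in I$ let $i_t\colon X\to X\times I$ be the morphism of ringed spaces given by $x\mapsto(x,t)$ and the identity $i_t^{-1}\mathcal O_{X\times I}=\mathcal O_X$. Let $X$ and $Y$ be ringed finite spaces. Two morphisms $f,g\colon X\to Y$ are homotopic, $f\sim g$, if there is a morphism of ringed spaces $H\colon X\times I\to Y$ with $H\circ i_0=f$ and $H\circ i_1=g$. Write $f\le g$ if for every $x\in X$ one has $f(x)\le g(x)$ and $g^\#_x\circ r_{f(x)g(x)}=f^\#_x$, where $f^\#_x\colon\mathcal O_{f(x)}\to\mathcal O_x$ and $g^\#_x\colon\mathcal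 O_{g(x)}\to\mathcal O_x$ are the maps induced on stalks; write $f\equiv g$ if $f\le g$ or $g\le f$. Proposition. Let $f,g\colon X\to Y$ be two morphisms of ringed finite spaces. Then $f\sim g$ if and only if there exist an integer $n\ge 0$ and morphisms of ringed spaces $f_0,\dots,f_n\colon X\to Y$ with $$f=f_0\equiv f_1\equiv\cdots\equiv f_n=g.$$ -/

import Mathlib

open CategoryTheory AlgebraicGeometry TopologicalSpace Opposite

universe u

noncomputable section

namespace RingedHomotopy

/-- The projection `X × [0,1] ⟶ X` of topological spaces. -/
def proj (X : TopCat.{u}) : TopCat.of (X × unitInterval) ⟶ X :=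
  TopCat.ofHom ⟨fun p => p.1, continuous_fst⟩

/-- The inclusion `X ⟶ X × [0,1]`, `x ↦ (x, t)`, of topological spaces. -/
def incl (X : TopCat.{u}) (t : unitInterval) : X ⟶ TopCat.of (X × unitInterval) :=
  TopCat.ofHom ⟨fun x => (x, t), by fun_prop⟩

/-- The ringed space `X × I`: the topological product of `X` with `[0,1]`, with the inverse
image `π⁻¹ 𝒪_X` of the structure sheaf of `X` under the projection `π : X × [0,1] ⟶ X`. -/
def cylinder (X : RingedSpace.{u, u}) : RingedSpace.{u, u} where
  carrier := TopCat.of (X.carrier × unitInterval)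
  presheaf := ((TopCat.Sheaf.pullback CommRingCat.{u} (proj X.carrier)).obj X.sheaf).obj
  IsSheaf := ((TopCat.Sheaf.pullback CommRingCat.{u} (proj X.carrier)).obj X.sheaf).property

theorem incl_proj_le (X : TopCat.{u}) (t : unitInterval) (U : Opens X) :
    (Opens.map (incl X t)).obj ((Opens.map (proj X)).obj U) ≤ U :=
  fun _ hx => hx

/-- The identification `𝒪_X = π_* (i_t)_* 𝒪_X` coming from `π ∘ i_t = id`. -/
def toPushforward (X : RingedSpace.{u, u}) (t : unitInterval) :
    X.sheaf ⟶ (TopCat.Sheaf.pushforward CommRingCat.{u} (proj X.carrier)).obj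
      ((TopCat.Sheaf.pushforward CommRingCat.{u} (incl X.carrier t)).obj X.sheaf) where
  hom :=
    { app := fun U => X.presheaf.map (homOfLE (incl_proj_le X.carrier t U.unop)).op
      naturality := fun U V i =>
        (X.presheaf.map_comp i (homOfLE (incl_proj_le X.carrier t V.unop)).op).symm.trans
          (X.presheaf.map_comp (homOfLE (incl_proj_le X.carrier t U.unop)).op
            ((Opens.map (incl X.carrier t)).map ((Opens.map (proj X.carrier)).map i.unop)).op) }

/-- The morphism of ringed spaces `i_t : X ⟶ X × I`: on points it is `x ↦ (x, t)`, on sheaves it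
is the map `π⁻¹ 𝒪_X ⟶ (i_t)_* 𝒪_X` adjoint to the identification `𝒪_X = π_* (i_t)_* 𝒪_X`
(equivalently, the identity `i_t⁻¹ π⁻¹ 𝒪_X = 𝒪_X`). -/
def cylinderIncl (X : RingedSpace.{u, u}) (t : unitInterval) : X ⟶ cylinder X :=
  InducedCategory.homMk
    { base := incl X.carrier t
      c := (((TopCat.Sheaf.pullbackPushforwardAdjunction CommRingCat.{u}
        (proj X.carrier)).homEquiv _ _).symm (toPushforward X t)).hom }

/-- `f` and `g` are homotopic: there is a morphism of ringed spaces `H : X × I ⟶ Y` with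
`H ∘ i_0 = f` and `H ∘ i_1 = g`. -/
def Homotopic {X Y : RingedSpace.{u, u}} (f g : X ⟶ Y) : Prop :=
  ∃ H : cylinder X ⟶ Y, cylinderIncl X 0 ≫ H = f ∧ cylinderIncl X 1 ≫ H = g

/-- The preorder `f ≤ g` on morphisms of ringed spaces. Points are ordered by `p ≤ q` iff `p` lies
in the closure of `q`, which is `q ⤳ p`; for `p ≤ q` the restriction morphism `𝒪_p ⟶ 𝒪_q` is
`stalkSpecializes`, and `𝒪_{f x} ⟶ 𝒪_x` is the stalk map of `f` at `x`. -/
def RingedLE {X Y : RingedSpace.{u, u}} (f g : X ⟶ Y) : Prop :=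
  ∃ h : ∀ x : X, g.hom.base x ⤳ f.hom.base x,
    ∀ x : X, Y.presheaf.stalkSpecializes (h x) ≫ g.hom.stalkMap x = f.hom.stalkMap x

/-- `f ≡ g`: either `f ≤ g` or `g ≤ f`. -/
def Comparable {X Y : RingedSpace.{u, u}} (f g : X ⟶ Y) : Prop :=
  RingedLE f g ∨ RingedLE g f

end RingedHomotopy

end

noncomputable section

/-! ### Stalks of an inverse image sheaf -/

namespace TopCat.Sheaf

/-! Preorder the morphisms `X ⟶ Y` by `RingedLE` and give them the upper set topology. Homotopies
then amount to continuous paths, and paths in an upper set topology connect exactly the points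
linked by zigzags (`joined_upperSet_iff`). The stalk of `π⁻¹ 𝒪_X` at `(x, t)` is `𝒪_{X,x}`, and its
sections are the families of germs that locally come from sections on `X`; in the `t` direction they
are locally constant. Finiteness gives smallest open neighbourhoods in `Y` and lets neighbourhoods
of `t` be intersected over `x`, so the slices of a homotopy near `t` lie above the slice at `t`
(`eventually_ringedLE_slice`). Conversely, a locally increasing family of morphisms glues to a
homotopy (`exists_slice_eq`). -/

theorem exists_germ_unit_eq {X Y : TopCat.{u}} (f : X ⟶ Y) (F : Y.Sheaf CommRingCat.{u}) (x : X)
    (a : ((pullback CommRingCat.{u} f).obj F).presheaf.stalk x) :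
    ∃ (U : Opens Y) (hU : f x ∈ U) (s : F.presheaf.obj (op U)),
      ((pullback CommRingCat.{u} f).obj F).presheaf.germ ((Opens.map f).obj U) x hU
        (((pullbackPushforwardAdjunction CommRingCat.{u} f).unit.app F).hom.app (op U) s) = a := by
  let e := Functor.sheafPullbackConstruction.sheafPullbackIso (Opens.map f) CommRingCat.{u}
    (Opens.grothendieckTopology Y) (Opens.grothendieckTopology X)
  let G := (Presheaf.pullback CommRingCat.{u} f).obj F.presheaf
  let τ : G ⟶ _ := toSheafify (Opens.grothendieckTopology X) G
  let ε : ((pullback CommRingCat.{u} f).obj F).presheaf ≅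
      sheafify (Opens.grothendieckTopology X) G :=
    (sheafToPresheaf _ _).mapIso (e.app F)
  -- Under `e` the sheaf unit becomes the presheaf unit followed by sheafification.
  have hunit (U : Opens Y) :
      ((pullbackPushforwardAdjunction CommRingCat.{u} f).unit.app F).hom.app (op U) ≫
        ε.hom.app (op ((Opens.map f).obj U)) =
      ((Presheaf.pullbackPushforwardAdjunction CommRingCat.{u} f).unit.app F.presheaf).app (op U) ≫
        τ.app (op ((Opens.map f).obj U)) := by
    have h : (pullbackPushforwardAdjunction CommRingCat.{u} f).unit.app F ≫
        (pushforward CommRingCat.{u} f).map (e.hom.app F) =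
        (Functor.sheafPullbackConstruction.sheafAdjunctionContinuous (Opens.map f)
          CommRingCat.{u} (Opens.grothendieckTopology Y)
          (Opens.grothendieckTopology X)).unit.app F :=
      Adjunction.unit_leftAdjointUniq_hom_app _ _ _
    exact congr_app ((sheafToPresheaf _ _).congr_map h) (op U)
  have hτ : IsIso ((Presheaf.stalkFunctor CommRingCat.{u} x).map τ) :=
    Presheaf.stalkFunctor_map_unit_toSheafify_isIso x CommRingCat.{u} G
  have hbij {A B : CommRingCat.{u}} (φ : A ⟶ B) [IsIso φ] : Function.Bijective φ :=
    ConcreteCategory.bijective_of_isIso φ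
  -- Sheafification preserves stalks, and the presheaf pullback has stalk `F` at `f x`; so `a`
  -- traces back to a germ of `F`.
  obtain ⟨c, hc⟩ := (hbij ((Presheaf.stalkFunctor CommRingCat.{u} x).map τ)).2
    ((Presheaf.stalkFunctor CommRingCat.{u} x).map ε.hom a)
  obtain ⟨d, rfl⟩ := (hbij (Presheaf.stalkPullbackIso CommRingCat.{u} f F.presheaf x).hom).2 c
  obtain ⟨U, hU, s, rfl⟩ := F.presheaf.exists_germ_eq d
  refine ⟨U, hU, s, (hbij ((Presheaf.stalkFunctor CommRingCat.{u} x).map ε.hom)).1 ?_⟩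
  have h1 := ConcreteCategory.congr_hom (hunit U) s
  have h2 := ConcreteCategory.congr_hom
    (Presheaf.germ_stalkPullbackHom CommRingCat.{u} f F.presheaf x U hU) s
  refine (Presheaf.stalkFunctor_map_germ_apply _ _ _ _ _).trans (.trans ?_ hc)
  refine (congrArg (ConcreteCategory.hom (Presheaf.germ (sheafify (Opens.grothendieckTopology X) G)
    ((Opens.map f).obj U) x hU)) h1).trans ?_
  refine (Presheaf.stalkFunctor_map_germ_apply _ _ _ _ _).symm.trans ?_
  exact congrArg (ConcreteCategory.hom ((Presheaf.stalkFunctor CommRingCat.{u} x).map τ)) h2.symm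

end TopCat.Sheaf

/-! ### Sections of the cylinder as families of germs -/

namespace RingedHomotopy

/-- The unit `𝒪_X ⟶ π_* π⁻¹ 𝒪_X`. -/
def cylinderUnit (X : RingedSpace.{u, u}) :
    X.sheaf ⟶ (TopCat.Sheaf.pushforward CommRingCat.{u} (proj X.carrier)).obj
      ((TopCat.Sheaf.pullback CommRingCat.{u} (proj X.carrier)).obj X.sheaf) :=
  (TopCat.Sheaf.pullbackPushforwardAdjunction CommRingCat.{u} (proj X.carrier)).unit.app X.sheaf

theorem cylinderUnit_comp (X : RingedSpace.{u, u}) (t : unitInterval) (U : Opens X) :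
    (cylinderUnit X).hom.app (op U) ≫
      (cylinderIncl X t).hom.c.app (op ((Opens.map (proj X.carrier)).obj U)) =
    X.presheaf.map (homOfLE (incl_proj_le X.carrier t U)).op := by
  let adj := TopCat.Sheaf.pullbackPushforwardAdjunction CommRingCat.{u} (proj X.carrier)
  have h := (adj.homEquiv_unit _ _ _).symm.trans
    ((adj.homEquiv _ _).apply_symm_apply (toPushforward X t))
  exact congr_app ((sheafToPresheaf _ _).congr_map h) (op U)

/-- The value in `𝒪_{X,x}` of a section of `𝒪_{X × I}` at the point `(x, t)`. -/
def cylinderEval (X : RingedSpace.{u, u}) (Ω : Opens (cylinder X)) (p : X × unitInterval)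
    (hp : (show cylinder X from p) ∈ Ω) :
    (cylinder X).presheaf.obj (op Ω) ⟶ X.presheaf.stalk p.1 :=
  (cylinder X).presheaf.germ Ω p hp ≫ (cylinderIncl X p.2).hom.stalkMap p.1

theorem cylinderEval_unit (X : RingedSpace.{u, u}) (U : Opens X) (p : X × unitInterval)
    (hp : p.1 ∈ U) (s : X.presheaf.obj (op U)) :
    cylinderEval X ((Opens.map (proj X.carrier)).obj U) p hp
      ((cylinderUnit X).hom.app (op U) s) = X.presheaf.germ U p.1 hp s := by
  have h1 := PresheafedSpace.stalkMap_germ (cylinderIncl X p.2).hom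
    ((Opens.map (proj X.carrier)).obj U) p.1 hp
  have h2 := cylinderUnit_comp X p.2 U
  have h3 : (cylinderUnit X).hom.app (op U) ≫
    cylinderEval X ((Opens.map (proj X.carrier)).obj U) p hp = X.presheaf.germ U p.1 hp := by
    refine (congrArg (fun z => (cylinderUnit X).hom.app (op U) ≫ z) h1).trans ?_
    refine (Category.assoc _ _ _).symm.trans ?_
    refine (congrArg (fun z => z ≫ _) h2).trans ?_
    exact X.presheaf.germ_res _ _ _
  exact ConcreteCategory.congr_hom h3 s

theorem cylinderEval_res (X : RingedSpace.{u, u}) {Ω Ω' : Opens (cylinder X)} (i : Ω' ⟶ Ω)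
    (p : X × unitInterval) (hp : (show cylinder X from p) ∈ Ω') (σ : (cylinder X).presheaf.obj (op Ω)) :
    cylinderEval X Ω' p hp ((cylinder X).presheaf.map i.op σ) = cylinderEval X Ω p (i.le hp) σ := by
  exact congrArg (ConcreteCategory.hom ((cylinderIncl X p.2).hom.stalkMap p.1))
    ((cylinder X).presheaf.germ_res_apply i p hp σ)

theorem exists_germ_cylinderUnit_eq (X : RingedSpace.{u, u}) (p : cylinder X)
    (a : (cylinder X).presheaf.stalk p) :
    ∃ (U : Opens X) (hU : p.1 ∈ U) (s : X.presheaf.obj (op U)),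
      (cylinder X).presheaf.germ ((Opens.map (proj X.carrier)).obj U) p hU
        ((cylinderUnit X).hom.app (op U) s) = a :=
  TopCat.Sheaf.exists_germ_unit_eq (proj X.carrier) X.sheaf p a

/-- Germs on the cylinder come from germs on `X`, which evaluation recovers; an equality of germs on
`X` holds on some `W`, hence on its preimage. -/
theorem cylinderIncl_stalkMap_injective (X : RingedSpace.{u, u}) (p : X × unitInterval) :
    Function.Injective ((cylinderIncl X p.2).hom.stalkMap p.1) := by
  intro a b hab
  obtain ⟨U, hU, s, rfl⟩ := exists_germ_cylinderUnit_eq X p a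
  obtain ⟨V, hV, r, rfl⟩ := exists_germ_cylinderUnit_eq X p b
  have h : X.presheaf.germ U p.1 hU s = X.presheaf.germ V p.1 hV r :=
    (cylinderEval_unit X U p hU s).symm.trans (hab.trans (cylinderEval_unit X V p hV r))
  obtain ⟨W, hW, iU, iV, hWr⟩ := X.presheaf.germ_eq p.1 hU hV s r h
  have key {U : Opens X} (iU : W ⟶ U) (hU : p.1 ∈ U) (s : X.presheaf.obj (op U)) :
     (cylinder X).presheaf.germ ((Opens.map (proj X.carrier)).obj U) p hU
        ((cylinderUnit X).hom.app (op U) s) =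
    (cylinder X).presheaf.germ ((Opens.map (proj X.carrier)).obj W) p hW
        ((cylinderUnit X).hom.app (op W) (X.presheaf.map iU.op s)) := by
    have h2 := ConcreteCategory.congr_hom ((cylinderUnit X).hom.naturality iU.op) s
    refine .trans ?_ (congrArg (ConcreteCategory.hom ((cylinder X).presheaf.germ
      ((Opens.map (proj X.carrier)).obj W) p hW)) h2.symm)
    exact ((cylinder X).presheaf.germ_res_apply ((Opens.map (proj X.carrier)).map iU) p hW _).symm
  rw [key iU, key iV, hWr]

theorem cylinder_section_ext (X : RingedSpace.{u, u}) {Ω : Opens (cylinder X)}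
    {σ τ : (cylinder X).presheaf.obj (op Ω)}
    (h : ∀ p hp, cylinderEval X Ω p hp σ = cylinderEval X Ω p hp τ) : σ = τ :=
  TopCat.Presheaf.section_ext (cylinder X).sheaf Ω σ τ fun p hp =>
    cylinderIncl_stalkMap_injective X p (h p hp)

theorem cylinderEval_locally_eq_germ (X : RingedSpace.{u, u}) {Ω : Opens (cylinder X)}
    (σ : (cylinder X).presheaf.obj (op Ω)) (p : X × unitInterval)
    (hp : (show cylinder X from p) ∈ Ω) :
    ∃ (W : Opens (cylinder X)) (_ : (show cylinder X from p) ∈ W) (hWΩ : W ≤ Ω)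
      (U : Opens X) (hWU : W ≤ (Opens.map (proj X.carrier)).obj U) (s : X.presheaf.obj (op U)),
      ∀ (q : X × unitInterval) (hq : (show cylinder X from q) ∈ W),
        cylinderEval X Ω q (hWΩ hq) σ = X.presheaf.germ U q.1 (hWU hq) s := by
  obtain ⟨U, hU, s, hs⟩ := exists_germ_cylinderUnit_eq X p ((cylinder X).presheaf.germ Ω p hp σ)
  obtain ⟨W, hW, i, j, hW'⟩ := (cylinder X).presheaf.germ_eq _ _ _ _ _ hs
  refine ⟨W, hW, j.le, U, i.le, s, fun q hq => ?_⟩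
  refine (cylinderEval_res X j q hq σ).symm.trans (.trans ?_ (cylinderEval_unit X U q (i.le hq) s))
  refine .trans ?_ (cylinderEval_res X i q hq _)
  exact congrArg (ConcreteCategory.hom (cylinderEval X W q hq)) hW'.symm

/-- The local sections pulled back from `X` agree on overlaps because evaluation separates sections.
-/
theorem exists_cylinder_section (X : RingedSpace.{u, u}) (Ω : Opens (cylinder X))
    (v : ∀ p : X × unitInterval, (show cylinder X from p) ∈ Ω → X.presheaf.stalk p.1)
    (hv : ∀ (p : X × unitInterval) (_ : (show cylinder X from p) ∈ Ω),
      ∃ (W : Opens (cylinder X)) (_ : (show cylinder X from p) ∈ W) (hWΩ : W ≤ Ω)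
      (U : Opens X) (hWU : W ≤ (Opens.map (proj X.carrier)).obj U) (s : X.presheaf.obj (op U)),
      ∀ (q : X × unitInterval) (hq : (show cylinder X from q) ∈ W),
        v q (hWΩ hq) = X.presheaf.germ U q.1 (hWU hq) s) :
    ∃ σ : (cylinder X).presheaf.obj (op Ω), ∀ p hp, cylinderEval X Ω p hp σ = v p hp := by
  choose W hW hWΩ U hWU s hs using fun p : Ω => hv p.1 p.2
  have hev (p : Ω) (q) (hq : (show cylinder X from q) ∈ W p) :
      cylinderEval X (W p) q hq ((cylinder X).presheaf.map (homOfLE (hWU p)).op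
        ((cylinderUnit X).hom.app (op (U p)) (s p))) = v q (hWΩ p hq) :=
    (cylinderEval_res X (homOfLE (hWU p)) q hq _).trans
      ((cylinderEval_unit X (U p) q (hWU p hq) (s p)).trans (hs p q hq).symm)
  obtain ⟨σ, hσ, -⟩ := TopCat.Sheaf.existsUnique_gluing' (cylinder X).sheaf W Ω
    (fun p => homOfLE (hWΩ p)) (fun p hp => Opens.mem_iSup.2 ⟨⟨p, hp⟩, hW ⟨p, hp⟩⟩)
    (fun p => (cylinder X).presheaf.map (homOfLE (hWU p)).op
      ((cylinderUnit X).hom.app (op (U p)) (s p))) (fun p p' =>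
        cylinder_section_ext X fun q hq =>
          (cylinderEval_res X _ q hq _).trans (((hev p q hq.1).trans
            (hev p' q hq.2).symm).trans (cylinderEval_res X _ q hq _).symm))
  refine ⟨σ, fun p hp => ?_⟩
  refine (cylinderEval_res X (homOfLE (hWΩ ⟨p, hp⟩)) p (hW ⟨p, hp⟩) σ).symm.trans ?_
  refine .trans ?_ (hev ⟨p, hp⟩ p (hW ⟨p, hp⟩))
  exact congrArg (ConcreteCategory.hom (cylinderEval X _ p (hW ⟨p, hp⟩))) (hσ ⟨p, hp⟩)

/-! ### The preorder on morphisms -/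

variable {X Y : RingedSpace.{u, u}}

theorem ringedLE_refl (f : X ⟶ Y) : RingedLE f f :=
  ⟨fun _ => specializes_rfl, fun x => by simp⟩

theorem RingedLE.trans {f g h : X ⟶ Y} (hfg : RingedLE f g) (hgh : RingedLE g h) :
    RingedLE f h := by
  obtain ⟨a, ha⟩ := hfg
  obtain ⟨b, hb⟩ := hgh
  refine ⟨fun x => (b x).trans (a x), fun x => ?_⟩
  rw [← ha, ← hb, TopCat.Presheaf.stalkSpecializes_comp_assoc]

/-- Morphisms of ringed spaces, preordered by `RingedLE`. -/
abbrev homPreorder (X Y : RingedSpace.{u, u}) : Preorder (X ⟶ Y) where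
  le := RingedLE
  le_refl := ringedLE_refl
  le_trans _ _ _ := RingedLE.trans

/-- Testing on sections removes `stalkSpecializes`, whose specialization argument is awkward to
carry along. -/
theorem ringedLE_iff_germ {f g : X ⟶ Y} :
    RingedLE f g ↔ ∀ (x : X) (V : Opens Y) (s : Y.presheaf.obj (op V)) (hf : f.hom.base x ∈ V),
      ∃ hg : g.hom.base x ∈ V, g.hom.stalkMap x (Y.presheaf.germ V _ hg s) =
        f.hom.stalkMap x (Y.presheaf.germ V _ hf s) := by
  constructor
  · rintro ⟨h, h'⟩ x V s hf
    refine ⟨(h x).mem_open V.2 hf, ?_⟩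
    rw [← h' x]
    exact congrArg (ConcreteCategory.hom (g.hom.stalkMap x)) (ConcreteCategory.congr_hom
      (TopCat.Presheaf.germ_stalkSpecializes Y.presheaf hf (h x)) s).symm
  · intro h
    have hs (x : X) : g.hom.base x ⤳ f.hom.base x :=
      -- The zero section serves only to extract the membership in `V`.
      specializes_iff_forall_open.2 fun V hV hf => (h x ⟨V, hV⟩ 0 hf).1
    refine ⟨hs, fun x => TopCat.Presheaf.stalk_hom_ext _ fun V hf => ?_⟩
    ext s
    obtain ⟨hg, e⟩ := h x V s hf
    refine .trans ?_ e
    exact congrArg (ConcreteCategory.hom (g.hom.stalkMap x)) (ConcreteCategory.congr_hom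
      (TopCat.Presheaf.germ_stalkSpecializes Y.presheaf hf (hs x)) s)

theorem RingedLE.eq_of_base_eq {f g : X ⟶ Y} (h : RingedLE f g) (hb : f.hom.base = g.hom.base) :
    f = g := by
  have key (φ : X.toPresheafedSpace ⟶ Y.toPresheafedSpace) (V : Opens Y)
      (s : Y.presheaf.obj (op V)) (x : X) (hx : φ.base x ∈ V) :
      φ.stalkMap x (Y.presheaf.germ V _ hx s) = X.presheaf.germ _ x hx (φ.c.app (op V) s) :=
    ConcreteCategory.congr_hom (PresheafedSpace.stalkMap_germ φ V x hx) s
  have h' := ringedLE_iff_germ.1 h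
  simp only [key] at h'
  obtain ⟨⟨fb, fc⟩⟩ := f
  obtain ⟨⟨gb, gc⟩⟩ := g
  obtain rfl : fb = gb := hb
  have hc : fc = gc := by
    refine NatTrans.ext (funext fun V => ?_)
    ext s
    exact TopCat.Presheaf.section_ext X.sheaf _ _ _ fun x hx => (h' x V.unop s hx).2.symm
  rw [hc]

/-! ### From homotopies to locally increasing families -/

/-- Every neighborhood in the unit interval contains a preconnected one. -/
theorem exists_isPreconnected_mem_nhds_unitInterval {t : unitInterval} {s : Set unitInterval}
    (hs : s ∈ nhds t) : ∃ J ∈ nhds t, _root_.IsPreconnected J ∧ J ⊆ s := by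
  obtain ⟨ε, hε, hsub⟩ := Metric.mem_nhds_iff.1 hs
  refine ⟨_, Metric.ball_mem_nhds t hε, Topology.IsInducing.subtypeVal.isPreconnected_image.1 ?_,
    hsub⟩
  have : Subtype.val '' Metric.ball t ε = Metric.ball (t : ℝ) ε ∩ Set.Icc 0 1 := by
    ext y
    simp only [Set.mem_image, Metric.mem_ball, Subtype.exists, Set.mem_inter_iff]
    exact ⟨fun ⟨z, hz, h, e⟩ => e ▸ ⟨h, hz⟩, fun ⟨h, hy⟩ => ⟨y, hy, h, rfl⟩⟩
  rw [this]
  exact ((convex_ball _ _).inter (convex_Icc 0 1)).isPreconnected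

/-- The slice at time `t` of a homotopy. -/
abbrev slice (H : cylinder X ⟶ Y) (t : unitInterval) : X ⟶ Y := cylinderIncl X t ≫ H

theorem slice_stalkMap_germ (H : cylinder X ⟶ Y) (t : unitInterval) (x : X) (V : Opens Y)
    (s : Y.presheaf.obj (op V)) (h : (slice H t).hom.base x ∈ V) :
    (slice H t).hom.stalkMap x (Y.presheaf.germ V _ h s) =
      cylinderEval X ((Opens.map H.hom.base).obj V) (x, t) h (H.hom.c.app (op V) s) := by
  have h1 := PresheafedSpace.stalkMap.comp (cylinderIncl X t).hom H.hom x
  refine (ConcreteCategory.congr_hom h1 (Y.presheaf.germ V _ h s)).trans ?_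
  exact congrArg (ConcreteCategory.hom ((cylinderIncl X t).hom.stalkMap x))
    (ConcreteCategory.congr_hom (PresheafedSpace.stalkMap_germ H.hom V _ h) s)

/-- Near each point `σ` has the germs of one section on `X`, so its value in the fixed stalk at `x`
is locally constant in `t`. -/
theorem cylinderEval_eq_of_isPreconnected {Ω : Opens (cylinder X)}
    (σ : (cylinder X).presheaf.obj (op Ω)) (x : X) {J : Set unitInterval} (hJ : _root_.IsPreconnected J)
    (hΩ : ∀ t ∈ J, (show cylinder X from (x, t)) ∈ Ω) {t t' : unitInterval} (ht : t ∈ J)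
    (ht' : t' ∈ J) :
    cylinderEval X Ω (x, t) (hΩ t ht) σ = cylinderEval X Ω (x, t') (hΩ t' ht') σ := by
  have : PreconnectedSpace J := Subtype.preconnectedSpace hJ
  let F (j : J) : X.presheaf.stalk x := cylinderEval X Ω (x, j.1) (hΩ j.1 j.2) σ
  have hloc : IsLocallyConstant F := by
    refine (IsLocallyConstant.iff_exists_open _).2 fun j => ?_
    have hc : Continuous fun i : J => (x, i.1) := by fun_prop
    obtain ⟨W, hW, hWΩ, U, hWU, s, hs⟩ := cylinderEval_locally_eq_germ X σ (x, j.1) (hΩ j.1 j.2)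
    refine ⟨{i : J | (show cylinder X from (x, i.1)) ∈ W},
      W.isOpen.preimage (f := fun i : J => (x, i.1)) hc, hW, fun i hi => ?_⟩
    exact (hs (x, i.1) hi).trans (hs (x, j.1) hW).symm
  exact hloc.apply_eq_of_preconnectedSpace ⟨t, ht⟩ ⟨t', ht'⟩

theorem eventually_ringedLE_slice [Finite X] [Finite Y] (H : cylinder X ⟶ Y) (t : unitInterval) :
    ∀ᶠ t' in nhds t, RingedLE (slice H t) (slice H t') := by
  have hx (x : X) : ∃ J ∈ nhds t, _root_.IsPreconnected J ∧
      ∀ t' ∈ J, (slice H t').hom.base x ⤳ (slice H t).hom.base x := by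
    have hc : Continuous fun t' => (slice H t').hom.base x :=
      H.hom.base.hom.continuous.comp (f := fun t' : unitInterval => (x, t')) (by fun_prop)
    have hn : {t' | (slice H t').hom.base x ⤳ (slice H t).hom.base x} ∈ nhds t := by
      -- As `Y` is finite, the generizations of a point form an open set.
      have : nhdsKer {(slice H t).hom.base x} ∈ nhds ((slice H t).hom.base x) :=
        isOpen_nhdsKer.mem_nhds (subset_nhdsKer rfl)
      filter_upwards [hc.continuousAt this] with t' ht'
      simpa [mem_nhdsKer_iff_specializes] using ht'
    exact exists_isPreconnected_mem_nhds_unitInterval hn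
  choose J hJ hJc hJs using hx
  -- As `X` is finite, one neighbourhood of `t` works for all `x`.
  filter_upwards [Filter.iInter_mem.2 hJ] with t' ht'
  refine ringedLE_iff_germ.2 fun x V s hf => ?_
  have hV (i) (hi : i ∈ J x) : (slice H i).hom.base x ∈ V := (hJs x i hi).mem_open V.2 hf
  have hx' := Set.mem_iInter.1 ht' x
  refine ⟨hV t' hx', ?_⟩
  rw [slice_stalkMap_germ, slice_stalkMap_germ]
  exact cylinderEval_eq_of_isPreconnected _ x (hJc x) hV hx' (mem_of_mem_nhds (hJ x))

/-! ### From locally increasing families to homotopies -/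

/-- The continuous map `X × [0,1] ⟶ Y` given by a locally increasing family. -/
def familyBase (γ : unitInterval → (X ⟶ Y))
    (hγ : ∀ t, ∀ᶠ t' in nhds t, RingedLE (γ t) (γ t')) :
    TopCat.of (X × unitInterval) ⟶ Y.carrier :=
  TopCat.ofHom ⟨fun p => (γ p.2).hom.base p.1, by
    refine continuous_iff_continuousAt.2 fun ⟨x, t⟩ => tendsto_nhds.2 fun V hV hx => ?_
    have h1 : (γ t).hom.base ⁻¹' V ∈ nhds x :=
      (hV.preimage (γ t).hom.base.hom.continuous).mem_nhds hx
    -- Open sets are stable under generization, so only `γ t` has to map the point into `V`.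
    filter_upwards [prod_mem_nhds h1 (hγ t)] with p hp
    exact (hp.2.1 p.1).mem_open hV hp.1⟩

/-- The ring homomorphism from sections on `Y` to stalks of `X` given by the member of the family
at the second coordinate. -/
def familyEval (γ : unitInterval → (X ⟶ Y))
    (hγ : ∀ t, ∀ᶠ t' in nhds t, RingedLE (γ t) (γ t')) (V : Opens Y) (p : X × unitInterval)
    (hp : (show cylinder X from p) ∈ (Opens.map (familyBase γ hγ)).obj V) :
    Y.presheaf.obj (op V) ⟶ X.presheaf.stalk p.1 :=
  Y.presheaf.germ V ((γ p.2).hom.base p.1) hp ≫ (γ p.2).hom.stalkMap p.1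

theorem exists_family_section (γ : unitInterval → (X ⟶ Y))
    (hγ : ∀ t, ∀ᶠ t' in nhds t, RingedLE (γ t) (γ t')) (V : Opens Y)
    (s : Y.presheaf.obj (op V)) :
    ∃ σ : (cylinder X).presheaf.obj (op ((Opens.map (familyBase γ hγ)).obj V)), ∀ p hp,
      cylinderEval X _ p hp σ = familyEval γ hγ V p hp s := by
  refine exists_cylinder_section X _ (fun p hp => familyEval γ hγ V p hp s) fun ⟨x, t⟩ hp => ?_
  obtain ⟨J, hJ, hJo, ht⟩ := mem_nhds_iff.1 (hγ t)
  let U : Opens X := (Opens.map (γ t).hom.base).obj V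
  -- On `U × J` every member lies above `γ t`, so all values are germs of the single section `(γ
  -- t)^# s`.
  refine ⟨⟨(U : Set X) ×ˢ J, U.2.prod hJo⟩, ⟨hp, ht⟩,
    fun q hq => ((hJ hq.2).1 q.1).mem_open V.2 hq.1, U, fun q hq => hq.1,
    (γ t).hom.c.app (op V) s, fun q hq => ?_⟩
  obtain ⟨_, h⟩ := ringedLE_iff_germ.1 (hJ hq.2) q.1 V s hq.1
  exact h.trans (ConcreteCategory.congr_hom (PresheafedSpace.stalkMap_germ _ V q.1 hq.1) s)

/-- Evaluation separates sections, so the ring laws and naturality reduce to those of each `γ t`. -/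
theorem exists_slice_eq (γ : unitInterval → (X ⟶ Y))
    (hγ : ∀ t, ∀ᶠ t' in nhds t, RingedLE (γ t) (γ t')) :
    ∃ H : cylinder X ⟶ Y, ∀ t, slice H t = γ t := by
  choose σ hσ using exists_family_section γ hγ
  have hext {V : Opens Y}
      {a b : (cylinder X).presheaf.obj (op ((Opens.map (familyBase γ hγ)).obj V))}
      (h : ∀ p hp, cylinderEval X _ p hp a = cylinderEval X _ p hp b) : a = b :=
    cylinder_section_ext X h
  let φ (V : Opens Y) : Y.presheaf.obj (op V) ⟶
      (cylinder X).presheaf.obj (op ((Opens.map (familyBase γ hγ)).obj V)) :=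
    CommRingCat.ofHom
      { toFun := σ V
        map_one' := hext fun p hp => by simp only [hσ, map_one]
        map_mul' := fun a b => hext fun p hp => by simp only [hσ, map_mul]
        map_zero' := hext fun p hp => by simp only [hσ, map_zero]
        map_add' := fun a b => hext fun p hp => by simp only [hσ, map_add] }
  have hφ (V s p hp) : cylinderEval X _ p hp (φ V s) = familyEval γ hγ V p hp s := hσ V s p hp
  let H : cylinder X ⟶ Y := InducedCategory.homMk
    { base := familyBase γ hγ
      c :=
        { app := fun V => φ V.unop
          naturality := fun V W i => by
            ext s
            refine hext fun p hp => (hφ _ _ p hp).trans (.trans ?_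
              (cylinderEval_res X ((Opens.map (familyBase γ hγ)).map i.unop) p hp _).symm)
            refine .trans ?_ (hφ _ _ _ _).symm
            exact congrArg (ConcreteCategory.hom ((γ p.2).hom.stalkMap p.1))
              (Y.presheaf.germ_res_apply i.unop _ hp s) } }
  refine ⟨H, fun t => RingedLE.eq_of_base_eq (ringedLE_iff_germ.2 fun x V s h => ⟨h, ?_⟩) rfl⟩
  exact ((slice_stalkMap_germ H t x V s h).trans (hφ V s (x, t) h)).symm

/-! ### Paths and chains -/

theorem homotopic_iff_joined [Finite X] [Finite Y] (f g : X ⟶ Y) :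
    letI := homPreorder X Y
    letI := Topology.upperSet (X ⟶ Y)
    Homotopic f g ↔ Joined f g := by
  let := homPreorder X Y
  let := Topology.upperSet (X ⟶ Y)
  have : Topology.IsUpperSet (X ⟶ Y) := ⟨rfl⟩
  -- The smallest neighbourhood of a morphism consists of those above it.
  have hcont (γ : unitInterval → (X ⟶ Y)) :
      Continuous γ ↔ ∀ t, ∀ᶠ t' in nhds t, RingedLE (γ t) (γ t') := by
    simp only [continuous_iff_continuousAt, ContinuousAt, Topology.IsUpperSet.nhds_eq_principal_Ici,
      Filter.tendsto_principal, Set.mem_Ici]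
    rfl
  constructor
  · rintro ⟨H, hf, hg⟩
    exact ⟨⟨⟨slice H, (hcont _).2 (eventually_ringedLE_slice H)⟩, hf, hg⟩⟩
  · rintro ⟨γ⟩
    obtain ⟨H, hH⟩ := exists_slice_eq γ ((hcont _).1 γ.continuous)
    exact ⟨H, (hH 0).trans γ.source, (hH 1).trans γ.target⟩

/-- In the upper set topology on a preorder, two points are joined by a path iff they are joined by
a chain of comparable elements. -/
theorem joined_upperSet_iff {α : Type*} [Preorder α] [TopologicalSpace α] [Topology.IsUpperSet α]
    (a b : α) : Joined a b ↔ Relation.ReflTransGen (fun x y => x ≤ y ∨ y ≤ x) a b := by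
  have hspec {x y : α} (h : x ≤ y) : Joined y x :=
    ((Topology.IsUpperSet.specializes_iff_le.2 h).joinedIn (Set.mem_univ y)
      (Set.mem_univ x)).joined
  constructor
  · rintro ⟨γ⟩
    -- Near `t` the path stays above `γ t`, so being linked to `a` is locally constant; the interval
    -- is connected.
    have hloc : IsLocallyConstant
        fun t => Relation.ReflTransGen (fun x y => x ≤ y ∨ y ≤ x) a (γ t) := by
      refine (IsLocallyConstant.iff_eventually_eq _).2 fun t => ?_
      have := γ.continuous.continuousAt (x := t)
      rw [ContinuousAt, Topology.IsUpperSet.nhds_eq_principal_Ici (γ t), Filter.tendsto_principal] at this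
      filter_upwards [this] with t' ht'
      exact propext ⟨fun h => h.tail (.inr ht'), fun h => h.tail (.inl ht')⟩
    have h := hloc.apply_eq_of_preconnectedSpace 0 1
    rw [γ.source, γ.target] at h
    exact h ▸ .refl
  · intro h
    induction h with
    | refl => exact .refl a
    | tail _ h ih => exact ih.trans (h.elim (fun h => (hspec h).symm) hspec)

/-- The reflexive transitive closure of a relation, by finite sequences. -/
theorem reflTransGen_iff_exists_fin {α : Type*} {r : α → α → Prop} {a b : α} :
    Relation.ReflTransGen r a b ↔ ∃ (n : ℕ) (F : Fin (n + 1) → α), F 0 = a ∧ F (Fin.last n) = b ∧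
      ∀ i : Fin n, r (F i.castSucc) (F i.succ) := by
  constructor
  · intro h
    induction h with
    | refl => exact ⟨0, fun _ => a, rfl, rfl, fun i => i.elim0⟩
    | @tail b c _ hbc ih =>
      obtain ⟨n, F, h0, hn, hF⟩ := ih
      refine ⟨n + 1, Fin.snoc F c, ?_, by simp, fun i => ?_⟩
      · rw [← Fin.castSucc_zero, Fin.snoc_castSucc, h0]
      · refine Fin.lastCases ?_ (fun i => ?_) i
        · rw [Fin.snoc_castSucc, Fin.succ_last, Fin.snoc_last, hn]
          exact hbc
        · rw [Fin.snoc_castSucc, Fin.succ_castSucc, Fin.snoc_castSucc]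
          exact hF i
  · rintro ⟨n, F, rfl, rfl, hF⟩
    exact Fin.induction .refl (fun i ih => ih.tail (hF i)) (Fin.last n)

end RingedHomotopy

end

theorem mainTheorem6 (X Y : AlgebraicGeometry.RingedSpace.{u, u}) [Finite X] [Finite Y]
    (f g : X ⟶ Y) :
    RingedHomotopy.Homotopic f g ↔
      ∃ (n : ℕ) (F : Fin (n + 1) → (X ⟶ Y)), F 0 = f ∧ F (Fin.last n) = g ∧
        ∀ i : Fin n, RingedHomotopy.Comparable (F i.castSucc) (F i.succ) := by
  let := RingedHomotopy.homPreorder X Y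
  let := Topology.upperSet (X ⟶ Y)
  have : Topology.IsUpperSet (X ⟶ Y) := ⟨rfl⟩
  exact (RingedHomotopy.homotopic_iff_joined f g).trans
    ((RingedHomotopy.joined_upperSet_iff f g).trans RingedHomotopy.reflTransGen_iff_exists_fin)
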